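/- Let $k$ be a field, $n\ge 2$, $A=k[x_1,\dots,x_n]$, $x=x_1\cdots x_n$, and let $B=A_x=k[x_1^{\pm1},\dots,x_n^{\pm1}]$. For $\alpha\in\mathbb Z^n$ write $x^\alpha=x_1^{\alpha_1}\cdots x_n^{\alpha_n}\in B$, $\alpha_+=\max(\alpha,0)$ and $\alpha_-=-\min(\alpha,0)$ (componentwise). Let $L$ be a positive critical binomial (PCB) matrix, i.e. an $n\times n$ integer matrix with positive diagonal entries and negative off-diagonal entries such that the entries of each row sum to zero. Let $I\subset A$ be the ideal generated by the $n$ binomials $x^{\alpha_+}-x^{\alpha_-}$, where $\alpha$ runs through the columns of $L$. Put $S(I)=IB\cap A$, let $m(I)$ be the last row of the adjugate matrix $\operatorname{adj}(L)$, and let $d$ be the greatest common divisor of the entries of $m(I)$. For an ideal $\mathfrak b$ of $B$ write $\mathfrak b^c=\mathfrak b\cap A$. The associated primes of an ideal $J$ of a ring $R$ are those of the $R$-module $R/J$, and $J$ is called unmixed if all its associated primes have the same height as $J$. (a) Let $PLQ=\operatorname{diag}(d_1,\dots,d_{n-1},0)$ be a normal decomposition (Smith normal form) of $L$: $P,Q$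 are integer matrices of determinant $\pm1$, and $d_1,\dots,d_{n-1}$ are positive integers (the invariant factors of $L$) with $d_i\mid d_j$ for $i\le j$. Let $r_1,\dots,r_n$ be the columns of $P^{-1}$ and put $y_i=x^{r_i}\in B$. Suppose that $k$ contains the $d_{n-1}$-th roots of unity and that $\operatorname{char}k$ is $0$ or a prime not dividing $d_{n-1}$. Let $\Lambda(D)$ be the set of all $\lambda=(\lambda_1,\dots,\lambda_{n-1})\in k^{n-1}$ with $\lambda_i^{d_i}=1$ for all $i$, and for $\lambda\in\Lambda(D)$ put $\mathfrak b_\lambda=(y_1-\lambda_1,\dots,y_{n-1}-\lambda_{n-1})B$. Then $$IB=\bigcap_{\lambda\in\Lambda(D)}\mathfrak b_\lambda\qquad\text{and}\qquad S(I)=\bigcap_{\lambda\in\Lambda(D)}\mathfrak b_\lambda^{c}$$ are minimal primary decompositions. In particular, $IB$ and $S(I)$ are unmixed, radical, and each has exactly $d$ distinct associated primes. (b) For an arbitrary field $k$, each of $IB$ and $S(I)$ has at most $d$ distinct associated primes. -/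

import Mathlib

namespace PCB

/-- A positive critical binomial matrix: an integer matrix with positive diagonal entries
`a i i` and negative off-diagonal entries `- a i j`, whose rows sum to zero. -/
structure IsPCB {n : ℕ} (L : Matrix (Fin n) (Fin n) ℤ) : Prop where
  diag_pos : ∀ i, 0 < L i i
  off_diag_neg : ∀ i j, i ≠ j → L i j < 0
  row_sum : ∀ i, ∑ j, L i j = 0

/-- The monomial `x ^ α₊`, where `α₊ = max (α, 0)`; then `x ^ α₋` is `posMonomial k (-α)`. -/
noncomputable def posMonomial (k : Type*) [Field k] {n : ℕ} (α : Fin n → ℤ) :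
    MvPolynomial (Fin n) k :=
  ∏ i, MvPolynomial.X i ^ (α i).toNat

/-- The binomial `x ^ α₊ - x ^ α₋` of an integer vector. -/
noncomputable def binomial (k : Type*) [Field k] {n : ℕ} (α : Fin n → ℤ) :
    MvPolynomial (Fin n) k :=
  posMonomial k α - posMonomial k (-α)

/-- The ideal of `A = k[x₁, …, xₙ]` generated by the binomials of the columns of `L`. -/
noncomputable def pcbIdeal (k : Type*) [Field k] {n : ℕ} (L : Matrix (Fin n) (Fin n) ℤ) :
    Ideal (MvPolynomial (Fin n) k) :=
  Ideal.span (Set.range fun j => binomial k (fun i => L i j))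

/-- The Laurent polynomial ring `B = S⁻¹A`, with `S` the set of powers of `x = x₁ ⋯ xₙ`. -/
abbrev LaurentRing (k : Type*) [Field k] (n : ℕ) : Type _ :=
  Localization.Away (∏ i : Fin n, (MvPolynomial.X i : MvPolynomial (Fin n) k))

theorem isUnit_algebraMap_X (k : Type*) [Field k] {n : ℕ} (i : Fin n) :
    IsUnit (algebraMap (MvPolynomial (Fin n) k) (LaurentRing k n) (MvPolynomial.X i)) :=
  isUnit_of_dvd_unit
    (map_dvd _ (Finset.dvd_prod_of_mem (fun i => (MvPolynomial.X i : MvPolynomial (Fin n) k))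
      (Finset.mem_univ i)))
    (IsLocalization.Away.algebraMap_isUnit
      (∏ i : Fin n, (MvPolynomial.X i : MvPolynomial (Fin n) k)))

/-- The variable `xᵢ` as a unit of `B`. -/
noncomputable def laurentX (k : Type*) [Field k] {n : ℕ} (i : Fin n) : (LaurentRing k n)ˣ :=
  (isUnit_algebraMap_X k i).unit

/-- The Laurent monomial `x ^ α` of `B`, for an integer vector `α`. -/
noncomputable def laurentMonomial (k : Type*) [Field k] {n : ℕ} (α : Fin n → ℤ) :
    LaurentRing k n :=
  ((∏ i, laurentX k i ^ α i : (LaurentRing k n)ˣ) : LaurentRing k n)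

/-- The extension `IB` to `B` of an ideal `I` of `A`. -/
noncomputable def ext {k : Type*} [Field k] {n : ℕ} (I : Ideal (MvPolynomial (Fin n) k)) :
    Ideal (LaurentRing k n) :=
  I.map (algebraMap (MvPolynomial (Fin n) k) (LaurentRing k n))

/-- The contraction `Jᶜ = J ∩ A` to `A` of an ideal `J` of `B`. -/
noncomputable def contr {k : Type*} [Field k] {n : ℕ} (J : Ideal (LaurentRing k n)) :
    Ideal (MvPolynomial (Fin n) k) :=
  J.comap (algebraMap (MvPolynomial (Fin n) k) (LaurentRing k n))

/-- `S(I) = IB ∩ A`. -/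
noncomputable def satur {k : Type*} [Field k] {n : ℕ} (I : Ideal (MvPolynomial (Fin n) k)) :
    Ideal (MvPolynomial (Fin n) k) :=
  contr (ext I)

/-- The integer vector `m(I)`: the last row of the adjugate matrix of `L`. -/
def mVec {N : ℕ} (L : Matrix (Fin (N + 2)) (Fin (N + 2)) ℤ) : Fin (N + 2) → ℤ :=
  L.adjugate (Fin.last (N + 1))

/-- `d = gcd (m(I))`. -/
def dGcd {N : ℕ} (L : Matrix (Fin (N + 2)) (Fin (N + 2)) ℤ) : ℕ :=
  Finset.univ.gcd fun j => (mVec L j).natAbs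

/-- `P M Q = diag (δ₁, …, δₙ)` is a normal decomposition of the square integer matrix `M`:
`P`, `Q` are invertible over `ℤ` and `δᵢ ∣ δⱼ` in `ℕ` for `i ≤ j`. As `0` divides only `0` and is
divisible by everything, the nonzero `δᵢ` (the invariant factors of `M`) come first, and there
are `rank M` of them. -/
structure IsNormalDecomposition {n : ℕ} (M P Q : Matrix (Fin n) (Fin n) ℤ) (δ : Fin n → ℕ) :
    Prop where
  isUnit_P : IsUnit P.det
  isUnit_Q : IsUnit Q.det
  eq_diagonal : P * M * Q = Matrix.diagonal fun i => (δ i : ℤ)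
  dvd : ∀ i j, i ≤ j → δ i ∣ δ j

/-- `yᵢ = x ^ rᵢ`, with `rᵢ` the `i`-th column of `R = P⁻¹`. -/
noncomputable def yCoord (k : Type*) [Field k] {n : ℕ} (P : Matrix (Fin n) (Fin n) ℤ)
    (i : Fin n) : LaurentRing k n :=
  laurentMonomial k fun l => P⁻¹ l i

/-- `𝔟_λ = (y₁ - λ₁, …, yₙ₋₁ - λₙ₋₁) B`, with `n = N + 2`. -/
noncomputable def bIdeal {k : Type*} [Field k] {N : ℕ}
    (P : Matrix (Fin (N + 2)) (Fin (N + 2)) ℤ) (lam : Fin (N + 1) → k) :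
    Ideal (LaurentRing k (N + 2)) :=
  Ideal.span (Set.range fun i : Fin (N + 1) =>
    yCoord k P i.castSucc - algebraMap k (LaurentRing k (N + 2)) (lam i))

/-- `Λ(D)`: the tuples `(λ₁, …, λₙ₋₁)` with `λᵢ` a `dᵢ`-th root of unity in `k`. -/
noncomputable def Lam (k : Type*) [Field k] {N : ℕ} (δ : Fin (N + 2) → ℕ) :
    Finset (Fin (N + 1) → k) :=
  Fintype.piFinset fun i => Polynomial.nthRootsFinset (δ i.castSucc) (1 : k)

open Classical in
/-- `I = ⋂_{i ∈ s} q i` is a minimal primary decomposition: the `q i`, `i ∈ s`, are primary, have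
distinct radicals, and none is redundant. (Injectivity makes this a statement about the
family and not just about the set of the `q i`.) -/
def IsMinimalPrimaryDecompositionOf {R ι : Type*} [CommRing R] (I : Ideal R) (s : Finset ι)
    (q : ι → Ideal R) : Prop :=
  Set.InjOn q s ∧ Submodule.IsMinimalPrimaryDecomposition I (s.image q)

/-- The set `Ass (R / I)` of associated primes of an ideal. -/
def Ass {R : Type*} [CommRing R] (I : Ideal R) : Set (Ideal R) :=
  associatedPrimes R (R ⧸ I)

/-- An ideal is unmixed if all its associated primes have the height of the ideal. -/
def IsUnmixed {R : Type*} [CommRing R] (I : Ideal R) : Prop :=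
  ∀ p ∈ Ass I, p.height = I.height

end PCB

/-! ### Kernel, rank and the vector `m(I)` of a PCB matrix. -/

namespace PCB

open Matrix

/-! In `B` each generator of `I` is a unit times `x ^ α - 1`, with `α` a column of `L`, so `B / IB`
is the group algebra of `ℤⁿ / Lℤⁿ`. A maximum principle shows that the kernel of a PCB matrix
consists of the constant vectors. Hence `L` has rank `n - 1`, and the quotient is `ℤ` times a finite
group `G`, whose order turns out to be `d`.

(a) In the coordinates `y` given by the columns of `P⁻¹`, the ideal `IB` is generated by the `yᵢ ^
dᵢ - 1` (`ext_pcbIdeal_eq_span_yCoord`). When these split into distinct linear factors, products of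
Lagrange basis polynomials form a partition of unity indexed by `Λ(D)`, which gives `IB = ⋂ 𝔟_λ`
(`span_yCoord_eq_inf`). Each `𝔟_λ` is the kernel of an evaluation with values in the domain
`k[T;T⁻¹]` (`ker_yEval`), and the `𝔟_λ` are pairwise incomparable. There are `∏ dᵢ = d` of them
(`prod_eq_dGcd`), all of one height because rescaling the `yᵢ` permutes such ideals. Contraction
from the localization `B` to `A` preserves all of this.

(b) Over any field, `B / IB` embeds into `k[T;T⁻¹][G]`, which is free of rank `d` over `k[T;T⁻¹]`
(`ker_toSplit_eq`). Associated primes of the kernel meet `k[T;T⁻¹]` in zero, so by integrality they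
are incomparable. Elements separating them are linearly independent, whence at most `d` primes
(`encard_Ass_ker_le`). -/

theorem IsPCB.eq_of_isMax {n : ℕ} {L : Matrix (Fin n) (Fin n) ℤ} (hL : IsPCB L) {u : Fin n → ℤ}
    {i : Fin n} (hi : ∀ j, u j ≤ u i) (h : (L *ᵥ u) i = 0) (j : Fin n) : u j = u i := by
  -- As row `i` sums to zero, `u i` may be subtracted from every entry of `u`. At a maximum all
  -- terms are then nonnegative, so each vanishes.
  have h0 : ∑ j, L i j * (u j - u i) = 0 := by
    simp only [mul_sub, Finset.sum_sub_distrib, ← Finset.sum_mul, hL.row_sum, zero_mul, sub_zero]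
    exact h
  have hnn : ∀ j ∈ Finset.univ, 0 ≤ L i j * (u j - u i) := by
    intro j _
    by_cases hij : i = j
    · subst hij; simp
    · exact mul_nonneg_of_nonpos_of_nonpos (hL.off_diag_neg i j hij).le (by linarith [hi j])
  have := (Finset.sum_eq_zero_iff_of_nonneg hnn).1 h0 j (Finset.mem_univ _)
  by_cases hij : i = j
  · rw [hij]
  · rcases mul_eq_zero.1 this with h | h
    · exact absurd h (hL.off_diag_neg i j hij).ne
    · linarith

theorem IsPCB.eq_of_mulVec_eq_zero {n : ℕ} {L : Matrix (Fin n) (Fin n) ℤ} (hL : IsPCB L)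
    {u : Fin n → ℤ} (h : L *ᵥ u = 0) (i j : Fin n) : u i = u j := by
  obtain ⟨m, -, hm⟩ := Finset.exists_max_image Finset.univ u ⟨i, Finset.mem_univ _⟩
  have := hL.eq_of_isMax (fun j => hm j (Finset.mem_univ _)) (congrFun h m)
  rw [this i, this j]

theorem IsPCB.mulVec_one {n : ℕ} {L : Matrix (Fin n) (Fin n) ℤ} (hL : IsPCB L) :
    L *ᵥ 1 = 0 := by
  ext i; simpa [mulVec, dotProduct] using hL.row_sum i

variable {N : ℕ} {L : Matrix (Fin (N + 2)) (Fin (N + 2)) ℤ}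

theorem IsPCB.det_eq_zero (hL : IsPCB L) : L.det = 0 :=
  exists_mulVec_eq_zero_iff.1 ⟨1, one_ne_zero, hL.mulVec_one⟩

theorem IsPCB.nonpos_of_mulVec (hL : IsPCB L) {u : Fin (N + 2) → ℤ} (h0 : u (Fin.last _) = 0)
    (h : ∀ i, i ≠ Fin.last _ → (L *ᵥ u) i = 0) (j) : u j ≤ 0 := by
  obtain ⟨m, -, hm⟩ := Finset.exists_max_image Finset.univ u ⟨0, Finset.mem_univ _⟩
  by_cases hl : m = Fin.last _
  · rw [← h0, ← hl]; exact hm j (Finset.mem_univ _)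
  · have := hL.eq_of_isMax (fun j => hm j (Finset.mem_univ _)) (h m hl)
    rw [this j, ← this (Fin.last _), h0]

/-- This entry is the determinant of `L` with its last row replaced by the last unit vector. A
kernel vector of that matrix vanishes at the last place, and the maximum principle applied to it and
to its negative makes it zero. -/
theorem IsPCB.mVec_last_ne_zero (hL : IsPCB L) : mVec L (Fin.last _) ≠ 0 := by
  rw [mVec, adjugate_apply]
  intro h
  obtain ⟨u, hu, h⟩ := exists_mulVec_eq_zero_iff.2 h
  have h0 : u (Fin.last _) = 0 := by
    have := congrFun h (Fin.last _)
    simpa [mulVec] using this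
  have h1 : ∀ i, i ≠ Fin.last _ → (L *ᵥ u) i = 0 := by
    intro i hi
    have := congrFun h i
    simpa [mulVec, updateRow_ne hi] using this
  apply hu
  ext j
  have a := hL.nonpos_of_mulVec h0 h1 j
  have b := hL.nonpos_of_mulVec (u := -u) (by simp [h0])
    (fun i hi => by rw [mulVec_neg, Pi.neg_apply, h1 i hi, neg_zero]) j
  simp only [Pi.neg_apply, Pi.zero_apply] at *
  omega

theorem IsPCB.mVec_vecMul (hL : IsPCB L) : mVec L ᵥ* L = 0 := by
  have : L.adjugate * L = 0 := by rw [adjugate_mul, hL.det_eq_zero, zero_smul]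
  exact congrFun this (Fin.last _)

theorem natCast_dGcd (L : Matrix (Fin (N + 2)) (Fin (N + 2)) ℤ) :
    (dGcd L : ℤ) = Finset.univ.gcd (mVec L) := by
  apply Int.dvd_antisymm (by positivity)
  · have := Finset.normalize_gcd (s := Finset.univ) (f := mVec L)
    rw [← this]; exact Int.nonneg_of_normalize_eq_self (normalize_idem _)
  · refine Finset.dvd_gcd fun j _ => Int.natCast_dvd.2 (Finset.gcd_dvd (Finset.mem_univ j))
  · rw [← Int.dvd_natAbs.trans Iff.rfl, Int.natAbs_natCast, Int.dvd_natCast]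
    refine Finset.dvd_gcd fun j _ => Int.natAbs_dvd_natAbs.2 (Finset.gcd_dvd (Finset.mem_univ j))

theorem IsPCB.dGcd_ne_zero (hL : IsPCB L) : dGcd L ≠ 0 := by
  intro h
  exact hL.mVec_last_ne_zero
    (Int.natAbs_eq_zero.1 (Finset.gcd_eq_zero_iff.1 h _ (Finset.mem_univ _)))

theorem det_updateCol_last (v : Fin (N + 2) → ℤ) :
    (L.updateCol (Fin.last _) v).det = mVec L ⬝ᵥ v := by
  rw [← cramer_apply, cramer_eq_adjugate_mulVec]; rfl

/-- Here `v` holds Bézout coefficients of `m(I)` and `w = m(I) / d`. The pair splits the free part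
off `ℤⁿ / Lℤⁿ`: `w` is the projection to `ℤ` and `v` a lift of `1`. Expanding along the replaced
column gives the determinant as `m(I) ⬝ v`. -/
theorem IsPCB.exists_bezout (hL : IsPCB L) : ∃ v w : Fin (N + 2) → ℤ,
    w ᵥ* L = 0 ∧ w ⬝ᵥ v = 1 ∧ (L.updateCol (Fin.last _) v).det = dGcd L := by
  obtain ⟨v, hv⟩ := Finset.gcd_eq_sum_mul Finset.univ (mVec L)
  rw [← natCast_dGcd] at hv
  have hd : (dGcd L : ℤ) ≠ 0 := by exact_mod_cast hL.dGcd_ne_zero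
  have hdvd : ∀ j, (dGcd L : ℤ) ∣ mVec L j := fun j =>
    Int.natCast_dvd.2 (Finset.gcd_dvd (Finset.mem_univ j))
  choose w hw using hdvd
  have hw' : mVec L = (dGcd L : ℤ) • w := funext hw
  refine ⟨v, w, ?_, ?_, ?_⟩
  · have := hL.mVec_vecMul
    rw [hw', smul_vecMul] at this
    exact (smul_eq_zero.1 this).resolve_left hd
  · have : (dGcd L : ℤ) * (w ⬝ᵥ v) = dGcd L * 1 := by
      rw [← smul_eq_mul, ← smul_dotProduct, ← hw', mul_one]; exact hv.symm
    exact mul_left_cancel₀ hd this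
  · rw [det_updateCol_last]; exact hv.symm

theorem natCard_quotient_range_mulVecLin {n : ℕ} (M : Matrix (Fin n) (Fin n) ℤ) (hM : M.det ≠ 0) :
    Nat.card ((Fin n → ℤ) ⧸ LinearMap.range M.mulVecLin) = M.det.natAbs := by
  have hinj : Function.Injective M.mulVecLin := by
    rw [← LinearMap.ker_eq_bot, LinearMap.ker_eq_bot']
    intro u hu
    by_contra h
    exact hM (exists_mulVec_eq_zero_iff.1 ⟨u, h, hu⟩)
  rw [← Submodule.natAbs_det_equiv _ (LinearEquiv.ofInjective _ hinj), ← LinearMap.det_toLin']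
  rfl

/-! ### Invariant factors of a PCB matrix. -/

section NormalDecomposition

variable {P Q : Matrix (Fin (N + 2)) (Fin (N + 2)) ℤ} {δ : Fin (N + 2) → ℕ}

theorem IsNormalDecomposition.last_eq_zero (hL : IsPCB L) (h : IsNormalDecomposition L P Q δ) :
    δ (Fin.last _) = 0 := by
  have := congrArg det h.eq_diagonal
  rw [det_mul, det_mul, hL.det_eq_zero, mul_zero, zero_mul, det_diagonal] at this
  obtain ⟨i, -, hi⟩ := Finset.prod_eq_zero_iff.1 this.symm
  have := h.dvd i _ (Fin.le_last i)
  rw [Int.natCast_eq_zero.1 hi] at this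
  exact zero_dvd_iff.1 this

theorem IsNormalDecomposition.mul_eq (h : IsNormalDecomposition L P Q δ) :
    L * Q = P⁻¹ * diagonal fun i => (δ i : ℤ) := by
  rw [← h.eq_diagonal, Matrix.mul_assoc P, nonsing_inv_mul_cancel_left _ _ h.isUnit_P]

theorem IsNormalDecomposition.eq_mul (h : IsNormalDecomposition L P Q δ) :
    L = P⁻¹ * (diagonal fun i => (δ i : ℤ)) * Q⁻¹ := by
  rw [← h.mul_eq, mul_nonsing_inv_cancel_right _ _ h.isUnit_Q]

/-- The diagonal entry `1` of `M⁻¹ * M` at `j` is a multiple of `c`. -/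
theorem isUnit_of_col_const {n : ℕ} {M : Matrix (Fin n) (Fin n) ℤ} (hM : IsUnit M.det) {j : Fin n}
    {c : ℤ} (h : ∀ i, M i j = c) : IsUnit c := by
  have : (M⁻¹ * M) j j = 1 := by rw [nonsing_inv_mul _ hM, one_apply_eq]
  rw [mul_apply] at this
  simp only [h, ← Finset.sum_mul] at this
  exact IsUnit.of_mul_eq_one_right _ this

theorem IsNormalDecomposition.exists_col (hL : IsPCB L) (h : IsNormalDecomposition L P Q δ)
    {i : Fin (N + 2)} (hi : δ i = 0) : ∃ c : ℤ, IsUnit c ∧ ∀ l, Q l i = c := by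
  have hz : L *ᵥ (fun l => Q l i) = 0 := by
    ext l
    have := congrFun (congrFun h.mul_eq l) i
    rw [mul_diagonal, hi, Nat.cast_zero, mul_zero] at this
    exact this
  refine ⟨Q 0 i, ?_, fun l => hL.eq_of_mulVec_eq_zero hz l 0⟩
  exact isUnit_of_col_const h.isUnit_Q fun l => hL.eq_of_mulVec_eq_zero hz l 0

theorem IsNormalDecomposition.castSucc_ne_zero (hL : IsPCB L)
    (h : IsNormalDecomposition L P Q δ) (i : Fin (N + 1)) : δ i.castSucc ≠ 0 := by
  intro hi
  obtain ⟨c, hc, hc'⟩ := h.exists_col hL hi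
  obtain ⟨c1, hc1, hc1'⟩ := h.exists_col hL (h.last_eq_zero hL)
  -- A second zero invariant factor would give `Q` two constant, hence proportional, columns.
  have key : Q *ᵥ (c1 • Pi.single i.castSucc 1 - c • Pi.single (Fin.last _) 1) = 0 := by
    ext l
    rw [mulVec_sub, Matrix.mulVec_smul, Matrix.mulVec_smul, mulVec_single_one, mulVec_single_one]
    simp only [Pi.sub_apply, Pi.smul_apply, col_apply, hc', hc1', smul_eq_mul, Pi.zero_apply]
    ring
  have : Q.det = 0 := by
    refine exists_mulVec_eq_zero_iff.1 ⟨_, fun h0 => ?_, key⟩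
    have := congrFun h0 (Fin.last _)
    simp [(Fin.castSucc_ne_last i).symm, hc.ne_zero] at this
  exact h.isUnit_Q.ne_zero this

/-- Taking adjugates in `L = P⁻¹ * D * Q⁻¹` gives `adj L = ± Q * adj D * P`, and `adj D` has a
single nonzero entry, the product of the `dᵢ`, in the last corner. As the last column of `Q` is
constant `±1`, the vector `m(I)` is up to sign that product times the last row of `P`, which is
primitive. -/
theorem IsNormalDecomposition.prod_eq_dGcd (hL : IsPCB L) (h : IsNormalDecomposition L P Q δ) :
    ∏ i : Fin (N + 1), δ i.castSucc = dGcd L := by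
  have hlast := h.last_eq_zero hL
  obtain ⟨c, hc, hc'⟩ := h.exists_col hL hlast
  set D : ℕ := ∏ i : Fin (N + 1), δ i.castSucc with hD
  have hadj : adjugate (diagonal fun i => (δ i : ℤ)) =
      diagonal (Pi.single (Fin.last _) (D : ℤ)) := by
    rw [adjugate_diagonal]
    congr 1
    ext i
    refine Fin.lastCases ?_ (fun i => ?_) i
    · rw [Pi.single_eq_same, hD, Nat.cast_prod]
      have := Fin.prod_univ_castSucc (fun i => if i = Fin.last (N+1) then (1:ℤ) else δ i)
      rw [Finset.prod_ite, Finset.filter_eq'] at this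
      simp [Fin.castSucc_ne_last] at this
      rw [← this]
      congr 1
      ext; simp
    · rw [Pi.single_eq_of_ne (Fin.castSucc_ne_last i)]
      refine Finset.prod_eq_zero (i := Fin.last _) ?_ (by simp [hlast])
      simp [(Fin.castSucc_ne_last i).symm]
  have hinv : ∀ {M : Matrix (Fin (N + 2)) (Fin (N + 2)) ℤ},
      IsUnit M.det → adjugate M⁻¹ = M⁻¹.det • M := by
    intro M hM
    have h1 : adjugate M⁻¹ * M⁻¹ * M = M⁻¹.det • M := by rw [adjugate_mul, smul_mul, one_mul]
    rwa [nonsing_inv_mul_cancel_right _ _ hM] at h1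
  have hm : ∀ j, mVec L j = Q⁻¹.det * P⁻¹.det * c * D * P (Fin.last _) j := by
    intro j
    have hh := congrFun (congrFun (congrArg adjugate h.eq_mul) (Fin.last _)) j
    rw [adjugate_mul_distrib, adjugate_mul_distrib, hadj, hinv h.isUnit_P, hinv h.isUnit_Q] at hh
    rw [mVec, hh]
    simp only [smul_mul, Matrix.mul_smul, Matrix.smul_apply, smul_eq_mul]
    rw [mul_apply, Finset.sum_eq_single (Fin.last _)]
    · simp only [hc', diagonal_mul, Pi.single_eq_same]; ring
    · intro b _ hb; simp [diagonal_mul, Pi.single_eq_of_ne hb]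
    · simp
  have hu : IsUnit (Q⁻¹.det * P⁻¹.det * c) :=
    ((isUnit_nonsing_inv_det Q h.isUnit_Q).mul (isUnit_nonsing_inv_det P h.isUnit_P)).mul hc
  have hu' : (Q⁻¹.det * P⁻¹.det * c).natAbs = 1 := Int.isUnit_iff_natAbs_eq.1 hu
  have hm' : ∀ j, (mVec L j).natAbs = D * (P (Fin.last _) j).natAbs := by
    intro j; rw [hm, Int.natAbs_mul, Int.natAbs_mul, hu', one_mul, Int.natAbs_natCast]
  rw [dGcd]
  simp only [hm']
  rw [Finset.gcd_mul_left]
  -- The gcd of the row divides the last diagonal entry of `P * P⁻¹`, which is `1`.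
  have : Finset.univ.gcd (fun j => (P (Fin.last _) j).natAbs) = 1 := by
    have h1 : (P * P⁻¹) (Fin.last _) (Fin.last _) = 1 := by
      rw [mul_nonsing_inv _ h.isUnit_P, one_apply_eq]
    rw [← Nat.dvd_one, ← Int.natCast_dvd_natCast, Nat.cast_one, ← h1, mul_apply]
    refine Finset.dvd_sum fun j _ => Dvd.dvd.mul_right ?_ _
    exact Int.natCast_dvd.2 (Finset.gcd_dvd (Finset.mem_univ j))
  rw [this]; simp
end NormalDecomposition
end PCB

/-! ### Laurent monomials and the universal property of `B`. -/

namespace PCB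

open MvPolynomial

/-- The exponential map `α ↦ g ^ α = ∏ i, g i ^ α i` of a tuple of units, with values in the
additive group of units. -/
noncomputable def unitExp {M : Type*} [CommGroup M] {n : ℕ} (g : Fin n → M) :
    (Fin n → ℤ) →ₗ[ℤ] Additive M :=
  Fintype.linearCombination ℤ fun i => Additive.ofMul (g i)

section unitExp
variable {M M' : Type*} [CommGroup M] [CommGroup M'] {n : ℕ}

theorem toMul_unitExp (g : Fin n → M) (α : Fin n → ℤ) :
    (unitExp g α).toMul = ∏ i, g i ^ α i := by
  simp [unitExp, Fintype.linearCombination_apply]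

theorem unitExp_single_one (g : Fin n → M) (i : Fin n) :
    unitExp g (Pi.single i 1) = Additive.ofMul (g i) := by
  simp [unitExp]

theorem map_unitExp (f : M →* M') (g : Fin n → M) (α : Fin n → ℤ) :
    f (unitExp g α).toMul = (unitExp (fun i => f (g i)) α).toMul := by
  simp [toMul_unitExp]

theorem unitExp_sum {ι : Type*} [Fintype ι] (g : Fin n → M) (c : ι → ℤ) (α : ι → Fin n → ℤ) :
    unitExp g (fun l => ∑ j, α j l * c j) = ∑ j, c j • unitExp g (α j) := by
  simp only [← map_smul, ← map_sum]
  congr 1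
  ext l
  simp [mul_comm]
end unitExp

variable {k : Type*} [Field k] {n : ℕ} {R : Type*} [CommRing R]

theorem laurentMonomial_eq (α : Fin n → ℤ) :
    laurentMonomial k α = ((unitExp (laurentX k) α).toMul : (LaurentRing k n)ˣ) := by
  rw [toMul_unitExp]; rfl

/-- The images of the variables under a ring homomorphism, as units. -/
noncomputable def varUnit (f : LaurentRing k n →+* R) (i : Fin n) : Rˣ :=
  Units.map (f : LaurentRing k n →* R) (laurentX k i)

theorem map_laurentMonomial (f : LaurentRing k n →+* R) (α : Fin n → ℤ) :
    f (laurentMonomial k α) = ((unitExp (varUnit f) α).toMul : Rˣ) := by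
  rw [laurentMonomial_eq]
  exact congrArg Units.val (map_unitExp (Units.map (f : LaurentRing k n →* R)) (laurentX k) α)

/-- The exponents with `x ^ α - 1` in `J` thus form a subgroup of `ℤⁿ`, so a change of generators of
such ideals is linear algebra over `ℤ`. -/
theorem laurentMonomial_sub_one_mem_iff (J : Ideal (LaurentRing k n)) (α : Fin n → ℤ) :
    laurentMonomial k α - 1 ∈ J ↔ unitExp (varUnit (Ideal.Quotient.mk J)) α = 0 := by
  rw [← Ideal.Quotient.eq_zero_iff_mem, map_sub, map_one, sub_eq_zero, map_laurentMonomial,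
    Units.val_eq_one]
  rfl

theorem isUnit_laurentMonomial (α : Fin n → ℤ) : IsUnit (laurentMonomial k α) := Units.isUnit _

theorem laurentMonomial_sub (α β : Fin n → ℤ) :
    laurentMonomial k (α - β) * laurentMonomial k β = laurentMonomial k α := by
  rw [laurentMonomial_eq, laurentMonomial_eq, laurentMonomial_eq, ← Units.val_mul, ← toMul_add,
    ← map_add, sub_add_cancel]

theorem algebraMap_posMonomial (α : Fin n → ℤ) :
    algebraMap (MvPolynomial (Fin n) k) (LaurentRing k n) (posMonomial k α) =
      laurentMonomial k fun i => ((α i).toNat : ℤ) := by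
  rw [posMonomial, map_prod, laurentMonomial, Units.coe_prod]
  refine Finset.prod_congr rfl fun i _ => ?_
  rw [map_pow, zpow_natCast, Units.val_pow_eq_pow_val]
  rfl

theorem algebraMap_binomial (α : Fin n → ℤ) :
    algebraMap (MvPolynomial (Fin n) k) (LaurentRing k n) (binomial k α) =
      (laurentMonomial k α - 1) * laurentMonomial k fun i => ((-α i).toNat : ℤ) := by
  have h : (fun i => ((α i).toNat : ℤ)) - (fun i => ((-α i).toNat : ℤ)) = α := by
    ext i; simp only [Pi.sub_apply]; omega
  have := laurentMonomial_sub (k := k) (fun i => ((α i).toNat : ℤ)) fun i => ((-α i).toNat : ℤ)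
  rw [h] at this
  rw [binomial, map_sub, algebraMap_posMonomial, algebraMap_posMonomial, sub_mul, one_mul, this]
  rfl

/-- Each binomial is `x ^ α - 1` times the unit `x ^ α₋`. -/
theorem ext_pcbIdeal (L : Matrix (Fin n) (Fin n) ℤ) :
    ext (pcbIdeal k L) =
      Ideal.span (Set.range fun j => laurentMonomial k (fun i => L i j) - 1) := by
  rw [ext, pcbIdeal, Ideal.map_span, ← Set.range_comp]
  apply le_antisymm <;> rw [Ideal.span_le] <;> rintro _ ⟨j, rfl⟩
  · simp only [Function.comp_apply, algebraMap_binomial]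
    exact Ideal.mul_mem_right _ _ (Ideal.subset_span ⟨j, rfl⟩)
  · have := Ideal.subset_span (α := LaurentRing k n)
      (Set.mem_range_self (f := algebraMap _ _ ∘ fun j => binomial k fun i => L i j) j)
    simp only [Function.comp_apply, algebraMap_binomial, SetLike.mem_coe] at this
    exact (Ideal.mul_unit_mem_iff_mem _ (isUnit_laurentMonomial _)).1 this

variable [Algebra k R]

/-- The homomorphism from the Laurent polynomial ring that sends the variables to given units. -/
noncomputable def laurentLift (g : Fin n → Rˣ) : LaurentRing k n →ₐ[k] R :=
  IsLocalization.liftAlgHom (M := Submonoid.powers (∏ i : Fin n, (X i : MvPolynomial (Fin n) k)))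
    (f := aeval fun i => (g i : R)) (by
      rintro ⟨_, m, rfl⟩
      rw [map_pow, map_prod]
      refine IsUnit.pow _ ?_
      simp only [aeval_X, ← Units.coe_prod]
      exact Units.isUnit _)

theorem laurentLift_X (g : Fin n → Rˣ) (i : Fin n) :
    laurentLift (k := k) g (algebraMap (MvPolynomial (Fin n) k) _ (X i)) = g i := by
  simp [laurentLift]

theorem varUnit_laurentLift (g : Fin n → Rˣ) :
    varUnit (laurentLift (k := k) g : LaurentRing k n →+* R) = g := by
  ext i; exact laurentLift_X g i

theorem laurentLift_laurentMonomial (g : Fin n → Rˣ) (α : Fin n → ℤ) :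
    laurentLift g (laurentMonomial k α) = ((unitExp g α).toMul : Rˣ) := by
  have := map_laurentMonomial (laurentLift (k := k) g : LaurentRing k n →+* R) α
  rwa [varUnit_laurentLift] at this

theorem laurentRing_algHom_ext {f g : LaurentRing k n →ₐ[k] R}
    (h : ∀ i, f (algebraMap (MvPolynomial (Fin n) k) _ (X i)) =
      g (algebraMap (MvPolynomial (Fin n) k) _ (X i))) : f = g := by
  refine IsLocalization.algHom_ext
    (Submonoid.powers (∏ i : Fin n, (X i : MvPolynomial (Fin n) k))) ?_
  ext i
  exact h i
end PCB

/-! ### Associated primes of kernels and of contractions. -/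

namespace PCB

section General
variable {R : Type*} [CommRing R]

theorem Ass_eq_associatedPrimes (I : Ideal R) : Ass I = Submodule.associatedPrimes I := by
  have key : ∀ x : R, (⊥ : Submodule R (R ⧸ I)).colon {Ideal.Quotient.mk I x} =
      Submodule.colon I {x} := by
    intro x
    ext r
    rw [Submodule.mem_colon_singleton, Submodule.mem_colon_singleton, Submodule.mem_bot,
      ← Ideal.Quotient.eq_zero_iff_mem, smul_eq_mul, map_mul, Algebra.smul_def]
    rfl
  ext p
  constructor
  · rintro ⟨hp, y, hy⟩
    obtain ⟨x, rfl⟩ := Ideal.Quotient.mk_surjective y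
    exact ⟨hp, x, by rw [hy, key]⟩
  · rintro ⟨hp, x, hx⟩
    exact ⟨hp, Ideal.Quotient.mk I x, by rw [hx, key]⟩

/-- Associated primes appear as the primes that are radicals of colon ideals `(I : a)`. Over
Noetherian rings, such as `A` and `B`, these are the usual ones. -/
theorem mem_Ass_iff {I p : Ideal R} :
    p ∈ Ass I ↔ p.IsPrime ∧ ∃ a, ∀ r, r ∈ p ↔ ∃ m : ℕ, r ^ m * a ∈ I := by
  rw [Ass_eq_associatedPrimes, Submodule.AssociatePrimes.mem_iff, Submodule.isAssociatedPrime_def]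
  simp only [SetLike.ext_iff, Ideal.mem_radical_iff, Submodule.mem_colon_singleton, smul_eq_mul]

theorem le_of_mem_Ass {I p : Ideal R} (hp : p ∈ Ass I) : I ≤ p := by
  obtain ⟨-, a, ha⟩ := mem_Ass_iff.1 hp
  exact fun r hr => (ha r).2 ⟨1, by simpa using I.mul_mem_right a hr⟩

theorem notMem_of_mem_Ass {I p : Ideal R} (hp : p.IsPrime) {a : R}
    (ha : ∀ r, r ∈ p ↔ ∃ m : ℕ, r ^ m * a ∈ I) : a ∉ I :=
  fun h => hp.ne_top ((Ideal.eq_top_iff_one _).2 ((ha 1).2 ⟨0, by simpa using h⟩))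

variable {D B E : Type*} [CommRing D] [CommRing B] [CommRing E] [Algebra D E]

/-- `B / ker Φ` embeds into the torsion-free `D`-module `E`, so no nonzero element of `D` is a zero
divisor on it. -/
theorem comap_eq_bot_of_mem_Ass_ker [IsDomain D] [Module.IsTorsionFree D E]
    (ψ : D →+* B) (Φ : B →+* E)
    (h : Φ.comp ψ = algebraMap D E) {p : Ideal B} (hp : p ∈ Ass (RingHom.ker Φ)) :
    p.comap ψ = ⊥ := by
  obtain ⟨hp, a, ha⟩ := mem_Ass_iff.1 hp
  have hna := notMem_of_mem_Ass hp ha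
  rw [eq_bot_iff]
  intro g hg
  obtain ⟨m, hm⟩ := (ha _).1 (Ideal.mem_comap.1 hg)
  rw [RingHom.mem_ker, map_mul, map_pow, ← RingHom.comp_apply, h, ← map_pow,
    ← Algebra.smul_def, smul_eq_zero] at hm
  exact eq_zero_of_pow_eq_zero (hm.resolve_right hna)

/-- Incomparability for the integral extension underlying `B / ker Φ`: an element of `q` outside `p`
satisfies a monic equation modulo `p`, and some coefficient would then lie in the contraction of `q`
but not in that of `p`. -/
theorem eq_of_le_of_comap_eq_bot [Algebra.IsIntegral D E] (ψ : D →+* B) (Φ : B →+* E)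
    (h : Φ.comp ψ = algebraMap D E) {p q : Ideal B} [hp : p.IsPrime] (hΦ : RingHom.ker Φ ≤ p)
    (hpq : p ≤ q) (hp0 : p.comap ψ = ⊥) (hq0 : q.comap ψ = ⊥) : p = q := by
  refine le_antisymm hpq fun b hb => ?_
  by_contra hbp
  obtain ⟨f, hf, hf0⟩ := Algebra.IsIntegral.isIntegral (R := D) (Φ b)
  have hne : f.map (Ideal.Quotient.mk (p.comap ψ)) ≠ 0 :=
    have := Ideal.Quotient.nontrivial_iff.2 (hp.comap ψ).ne_top
    (hf.map _).ne_zero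
  have hmem : f.eval₂ ψ b ∈ p := by
    refine hΦ ?_
    rw [RingHom.mem_ker, Polynomial.hom_eval₂, h, hf0]
  obtain ⟨i, hi, hi'⟩ :=
    Ideal.exists_coeff_mem_comap_sdiff_comap_of_root_mem_sdiff hpq ⟨hb, hbp⟩ hne hmem
  rw [hp0] at hi'
  rw [hq0] at hi
  exact hi' hi

/-- For finitely many associated primes, choose for each one an element outside it but inside all
the others. The images of these elements in `E` are linearly independent over `D`, so the rank
bounds their number. -/
theorem encard_Ass_ker_le [IsDomain D] [Module.Free D E] [Module.Finite D E]
    (ψ : D →+* B) (Φ : B →+* E)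
    (h : Φ.comp ψ = algebraMap D E) :
    (Ass (RingHom.ker Φ)).encard ≤ Module.finrank D E := by
  classical
  by_contra! hlt
  obtain ⟨t, htA, ht⟩ := Set.exists_subset_encard_eq (Order.add_one_le_of_lt hlt)
  have htfin : t.Finite := Set.finite_of_encard_eq_coe (k := Module.finrank D E + 1)
    (by simpa using ht)
  have := htfin.fintype
  have hpr : ∀ p : t, (p : Ideal B).IsPrime := fun p => (htA p.2).1
  have h0 : ∀ p : t, (p : Ideal B).comap ψ = ⊥ := fun p =>
    comap_eq_bot_of_mem_Ass_ker ψ Φ h (htA p.2)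
  have hex : ∀ p : t, ∃ e : B, e ∉ (p : Ideal B) ∧ ∀ q : t, q ≠ p → e ∈ (q : Ideal B) := by
    intro p
    -- A prime containing a finite intersection contains one of its members, which incomparability
    -- forbids.
    have hnle : ¬ (Finset.univ.erase p).inf (fun q : t => (q : Ideal B)) ≤ p := by
      intro hle
      obtain ⟨q, hq, hqp⟩ := (hpr p).inf_le'.1 hle
      have := hpr q
      exact Finset.ne_of_mem_erase hq (Subtype.ext
        (eq_of_le_of_comap_eq_bot ψ Φ h (le_of_mem_Ass (htA q.2)) hqp (h0 q) (h0 p)))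
    obtain ⟨e, he, hep⟩ := SetLike.not_le_iff_exists.1 hnle
    refine ⟨e, hep, fun q hq => ?_⟩
    exact (Finset.inf_le (f := fun q : t => (q : Ideal B))
      (Finset.mem_erase.2 ⟨hq, Finset.mem_univ q⟩)) he
  choose e hep he using hex
  have hli : LinearIndependent D fun p : t => Φ (e p) := by
    rw [Fintype.linearIndependent_iff]
    intro c hc p
    have hker : ∑ q, ψ (c q) * e q ∈ RingHom.ker Φ := by
      rw [RingHom.mem_ker, map_sum, ← hc]
      refine Finset.sum_congr rfl fun q _ => ?_
      rw [map_mul, ← RingHom.comp_apply, h, Algebra.smul_def]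
    -- Modulo `p` only the term of `p` survives in the relation. Its coefficient lies in `p`, hence
    -- in the zero contraction of `p` to `D`.
    have hmem := le_of_mem_Ass (htA p.2) hker
    rw [← Finset.add_sum_erase _ _ (Finset.mem_univ p), Ideal.add_mem_iff_left] at hmem
    · have : c p ∈ (p : Ideal B).comap ψ := ((hpr p).mem_or_mem hmem).resolve_right (hep p)
      rwa [h0 p, Ideal.mem_bot] at this
    · exact Ideal.sum_mem _ fun q hq =>
        Ideal.mul_mem_left _ _ (he q p (Finset.ne_of_mem_erase hq).symm)
  have hcard := hli.fintype_card_le_finrank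
  have : (Fintype.card t : ℕ∞) = (Module.finrank D E : ℕ∞) + 1 := by
    rw [← ht, Set.encard_eq_coe_toFinset_card, Set.toFinset_card]
  have : Fintype.card t = Module.finrank D E + 1 := by exact_mod_cast this
  omega

/-- A radical of `(Jᶜ : a)` is the contraction of the radical of `(J : a)` taken in `B`, and the
latter is prime because its contraction is. -/
theorem Ass_comap_subset {A B : Type*} [CommRing A] [CommRing B] [Algebra A B] (S : Submonoid A)
    [IsLocalization S B] (J : Ideal B) :
    Ass (J.comap (algebraMap A B)) ⊆ Ideal.comap (algebraMap A B) '' Ass J := by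
  intro p hp
  obtain ⟨hp, a, ha⟩ := mem_Ass_iff.1 hp
  have hcomap : (Submodule.colon J {algebraMap A B a}).radical.comap (algebraMap A B) = p := by
    ext r
    rw [ha, Ideal.mem_comap, Ideal.mem_radical_iff]
    simp only [Submodule.mem_colon_singleton, smul_eq_mul, Ideal.mem_comap, map_mul, map_pow]
  refine ⟨_, mem_Ass_iff.2 ⟨?_, algebraMap A B a, fun r => ?_⟩, hcomap⟩
  · refine (IsLocalization.isPrime_iff_isPrime_disjoint S _ _).2 ⟨?_, ?_⟩
    · rw [Ideal.under, hcomap]; exact hp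
    refine (IsLocalization.disjoint_under_iff S B _).2 fun htop => hp.ne_top ?_
    rw [← hcomap, htop, Ideal.comap_top]
  · rw [Ideal.mem_radical_iff]
    simp only [Submodule.mem_colon_singleton, smul_eq_mul]

end General
end PCB

/-! ### The quotient `B / IB` inside a group algebra, over any field. -/

namespace PCB

open Matrix

section OfHom
variable {k : Type*} [Field k] {n : ℕ} {R : Type*} [CommRing R] [Algebra k R]

/-- The homomorphism from the Laurent polynomial ring with prescribed values on monomials. -/
noncomputable def laurentOfHom (μ : Multiplicative (Fin n → ℤ) →* R) : LaurentRing k n →ₐ[k] R :=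
  laurentLift fun i => μ.toHomUnits (Multiplicative.ofAdd (Pi.single i 1))

theorem laurentOfHom_laurentMonomial (μ : Multiplicative (Fin n → ℤ) →* R) (u : Fin n → ℤ) :
    laurentOfHom μ (laurentMonomial k u) = μ (Multiplicative.ofAdd u) := by
  rw [laurentOfHom, laurentLift_laurentMonomial]
  have : unitExp (fun i => μ.toHomUnits (Multiplicative.ofAdd (Pi.single i 1))) =
      (MonoidHom.toAdditiveRight μ.toHomUnits).toIntLinearMap := by
    ext i
    simp [unitExp]
  rw [this]
  rfl
end OfHom

section Arbitrary
variable {k : Type*} [Field k] {n : ℕ}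

/-- The finite abelian group presented by the columns of a square integer matrix. -/
abbrev ColQuot (M : Matrix (Fin n) (Fin n) ℤ) : Type := (Fin n → ℤ) ⧸ LinearMap.range M.mulVecLin

/-- The group algebra of `ColQuot M × ℤ`, as an algebra over the group algebra of `ℤ`. -/
abbrev SplitAlg (k : Type*) [Field k] (M : Matrix (Fin n) (Fin n) ℤ) : Type _ :=
  AddMonoidAlgebra (LaurentPolynomial k) (ColQuot M)

/-- The monomial of `SplitAlg k M` at `(a, c)`. -/
noncomputable def splitMonomial (M : Matrix (Fin n) (Fin n) ℤ) (a : ColQuot M) (c : ℤ) :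
    SplitAlg k M := AddMonoidAlgebra.single a (LaurentPolynomial.T c)

theorem splitMonomial_mul (M : Matrix (Fin n) (Fin n) ℤ) (a a' : ColQuot M) (c c' : ℤ) :
    splitMonomial (k := k) M a c * splitMonomial M a' c' = splitMonomial M (a + a') (c + c') := by
  rw [splitMonomial, splitMonomial, AddMonoidAlgebra.single_mul_single, ← LaurentPolynomial.T_add,
    splitMonomial]

theorem splitMonomial_zero (M : Matrix (Fin n) (Fin n) ℤ) :
    splitMonomial (k := k) M 0 0 = 1 := by
  rw [splitMonomial, LaurentPolynomial.T_zero]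
  rfl

/-- The homomorphism `x ^ u ↦ single [u] (T ^ (w ⬝ u))`. -/
noncomputable def toSplit (k : Type*) [Field k] (M : Matrix (Fin n) (Fin n) ℤ) (w : Fin n → ℤ) :
    LaurentRing k n →ₐ[k] SplitAlg k M :=
  laurentOfHom
    { toFun := fun u => splitMonomial M (Submodule.Quotient.mk u.toAdd) (w ⬝ᵥ u.toAdd)
      map_one' := by
        rw [toAdd_one, dotProduct_zero]
        exact splitMonomial_zero M
      map_mul' := fun u u' => by
        rw [toAdd_mul, dotProduct_add, splitMonomial_mul]
        rfl }

theorem toSplit_laurentMonomial (M : Matrix (Fin n) (Fin n) ℤ) (w u : Fin n → ℤ) :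
    toSplit k M w (laurentMonomial k u) = splitMonomial M (Submodule.Quotient.mk u) (w ⬝ᵥ u) :=
  laurentOfHom_laurentMonomial _ u

/-- Such an `f` factors through `toSplit`: write `u = (u - (w ⬝ u) v) + (w ⬝ u) v`. The value of `f`
at the first summand depends only on the class of `u`, and the second is accounted for by `T ↦ f (x
^ v)`. -/
theorem ker_toSplit_le {R : Type*} [CommRing R] [Algebra k R] (M : Matrix (Fin n) (Fin n) ℤ)
    (v w : Fin n → ℤ) (f : LaurentRing k n →ₐ[k] R)
    (h : ∀ j, f (laurentMonomial k (M.col j - (w ⬝ᵥ M.col j) • v)) = 1) :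
    RingHom.ker (toSplit k M w) ≤ RingHom.ker f := by
  set e := unitExp (varUnit (f : LaurentRing k n →+* R)) with he
  have hfe : ∀ u, f (laurentMonomial k u) = ((e u).toMul : Rˣ) :=
    map_laurentMonomial (f : LaurentRing k n →+* R)
  let fD : LaurentPolynomial k →ₐ[k] R := AddMonoidAlgebra.lift k _ ℤ
    ((Units.coeHom _).comp (AddMonoidHom.toMultiplicativeLeft (zmultiplesHom _ (e v))))
  have hfD : ∀ c : ℤ, fD (LaurentPolynomial.T c) = ((c • e v).toMul : Rˣ) := by
    intro c
    simp only [fD, LaurentPolynomial.T]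
    rw [AddMonoidAlgebra.lift_single, one_smul]
    rfl
  let _ : Algebra (LaurentPolynomial k) R := fD.toRingHom.toAlgebra
  let proj : (Fin n → ℤ) →ₗ[ℤ] Additive Rˣ :=
    e ∘ₗ (LinearMap.id - (dotProductBilin ℤ ℤ w).smulRight v)
  have hproj : LinearMap.range M.mulVecLin ≤ LinearMap.ker proj := by
    rw [range_mulVecLin, Submodule.span_le]
    rintro _ ⟨j, rfl⟩
    have := h j
    rw [hfe, Units.val_eq_one] at this
    exact this
  let fT : ColQuot M →ₗ[ℤ] Additive Rˣ := Submodule.liftQ _ proj hproj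
  let Ψ : SplitAlg k M →ₐ[LaurentPolynomial k] R := AddMonoidAlgebra.lift _ _ _
    ((Units.coeHom _).comp (AddMonoidHom.toMultiplicativeLeft fT.toAddMonoidHom))
  have hmon : ∀ u : Fin n → ℤ, Ψ (splitMonomial M (Submodule.Quotient.mk u) (w ⬝ᵥ u)) =
      f (laurentMonomial k u) := by
    intro u
    have h1 : Ψ (splitMonomial M (Submodule.Quotient.mk u) (w ⬝ᵥ u)) =
        (LaurentPolynomial.T (w ⬝ᵥ u) : LaurentPolynomial k) • (((proj u).toMul : Rˣ) : R) := by
      simp only [Ψ, splitMonomial]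
      rw [AddMonoidAlgebra.lift_single]
      rfl
    rw [h1, Algebra.smul_def]
    change fD _ * _ = _
    rw [hfD, hfe, ← Units.val_mul, ← toMul_add]
    have hp : proj u = e u - (w ⬝ᵥ u) • e v := by
      rw [← map_smul, ← map_sub]; rfl
    rw [hp, add_sub_cancel]
  have hC : ∀ c : k, Ψ (algebraMap k _ c) = algebraMap k R c := by
    intro c
    rw [IsScalarTower.algebraMap_apply k (LaurentPolynomial k) (SplitAlg k M), Ψ.commutes]
    exact fD.commutes c
  let Ψk : SplitAlg k M →ₐ[k] R := { Ψ.toRingHom with commutes' := hC }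
  have hcomp : Ψk.comp (toSplit k M w) = f := by
    refine laurentRing_algHom_ext fun i => ?_
    have hX : algebraMap (MvPolynomial (Fin n) k) (LaurentRing k n) (MvPolynomial.X i) =
        laurentMonomial k (Pi.single i 1) := by
      rw [laurentMonomial_eq, unitExp_single_one]; rfl
    rw [hX, AlgHom.comp_apply, toSplit_laurentMonomial]
    exact hmon _
  intro b hb
  rw [RingHom.mem_ker] at hb ⊢
  rw [← hcomp, AlgHom.comp_apply, hb, map_zero]
end Arbitrary
end PCB

namespace PCB

open Matrix
variable {k : Type*} [Field k] {N : ℕ} {L : Matrix (Fin (N + 2)) (Fin (N + 2)) ℤ}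

/-- The map `u ↦ ([u], w ⬝ u)` has kernel exactly `Lℤⁿ`: its last column being redundant, `L`
differs from `M` only by the generator `v`, and `w` is `1` on `v` and `0` on `Lℤⁿ`. -/
theorem ker_toSplit_eq (hL : IsPCB L) {v w : Fin (N + 2) → ℤ} (hwL : w ᵥ* L = 0)
    (hwv : w ⬝ᵥ v = 1) :
    RingHom.ker (toSplit k (L.updateCol (Fin.last _) v) w) = ext (pcbIdeal k L) := by
  set M := L.updateCol (Fin.last _) v with hM
  have hcol : ∀ j, j ≠ Fin.last _ → M.col j = L.col j := by
    intro j hj; ext i; simp [hM, updateCol_ne hj]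
  have hlast : M.col (Fin.last _) = v := by ext i; simp [hM]
  have hw : ∀ j, w ⬝ᵥ L.col j = 0 := fun j => congrFun hwL j
  rw [ext_pcbIdeal]
  apply le_antisymm
  · conv_rhs => rw [← Ideal.mk_ker (I := Ideal.span _)]
    refine (ker_toSplit_le M v w (Ideal.Quotient.mkₐ k _) fun j => ?_).trans le_rfl
    rw [← sub_eq_zero, ← map_one (Ideal.Quotient.mkₐ k _), ← map_sub]
    refine Ideal.Quotient.eq_zero_iff_mem.2 ?_
    by_cases hj : j = Fin.last _
    · rw [hj, hlast, hwv, one_smul, sub_self]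
      simp [laurentMonomial]
    · rw [hcol j hj, hw, zero_smul, sub_zero]
      exact Ideal.subset_span ⟨j, rfl⟩
  · rw [Ideal.span_le]
    rintro _ ⟨j, rfl⟩
    have hmem : L.col j ∈ LinearMap.range M.mulVecLin := by
      have hne : ∀ j, j ≠ Fin.last _ → L.col j ∈ LinearMap.range M.mulVecLin := by
        intro j hj
        rw [← hcol j hj, range_mulVecLin]
        exact Submodule.subset_span ⟨j, rfl⟩
      by_cases hj : j = Fin.last _
      -- The zero row sums make the last column a combination of the others, so replacing it by `v`
      -- loses nothing.
      · have hs : L.col (Fin.last _) = -∑ i : Fin (N + 1), L.col i.castSucc := by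
          ext i
          have := hL.row_sum i
          rw [Fin.sum_univ_castSucc] at this
          simp only [col_apply, Pi.neg_apply, Finset.sum_apply]
          linarith
        rw [hj, hs]
        exact Submodule.neg_mem _ (Submodule.sum_mem _ fun i _ => hne _ (Fin.castSucc_ne_last i))
      · exact hne j hj
    simp only [SetLike.mem_coe, RingHom.mem_ker, map_sub, map_one]
    rw [sub_eq_zero]
    have := toSplit_laurentMonomial (k := k) M w (L.col j)
    rw [hw, (Submodule.Quotient.mk_eq_zero _).2 hmem, splitMonomial_zero] at this
    exact this

theorem encard_Ass_ext_le (k : Type*) [Field k] (hL : IsPCB L) :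
    (Ass (ext (pcbIdeal k L))).encard ≤ dGcd L := by
  obtain ⟨v, w, hwL, hwv, hdet⟩ := hL.exists_bezout
  have hd : (L.updateCol (Fin.last _) v).det ≠ 0 := by
    rw [hdet]; exact_mod_cast hL.dGcd_ne_zero
  have hcard := natCard_quotient_range_mulVecLin _ hd
  rw [← ker_toSplit_eq hL hwL hwv]
  set M := L.updateCol (Fin.last _) v with hM
  have : Finite (ColQuot M) := by
    refine Nat.finite_of_card_ne_zero ?_
    rw [hcard]; exact Int.natAbs_ne_zero.2 hd
  have := Fintype.ofFinite (ColQuot M)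
  have hrank : Module.finrank (LaurentPolynomial k) (SplitAlg k M) = dGcd L := by
    rw [Module.finrank_eq_card_basis (AddMonoidAlgebra.basis _ _),
      ← Nat.card_eq_fintype_card, hcard, hdet, Int.natAbs_natCast]
  have h1 : ∀ c : ℤ, toSplit k M w (laurentMonomial k (c • v)) =
      splitMonomial M (Submodule.Quotient.mk (c • v)) c := by
    intro c
    rw [toSplit_laurentMonomial, dotProduct_smul, hwv]; simp
  have hv : v ∈ LinearMap.range M.mulVecLin := by
    rw [range_mulVecLin]
    refine Submodule.subset_span ⟨Fin.last _, ?_⟩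
    ext i; simp [hM]
  rw [← hrank]
  -- The base ring enters `B` by `T ↦ x ^ v`. Since `v` is a column of `M` and `w ⬝ v = 1`, the
  -- composite with `toSplit` is the structure map.
  let ψ : LaurentPolynomial k →ₐ[k] LaurentRing k (N + 2) := AddMonoidAlgebra.lift k _ ℤ
    ((Units.coeHom _).comp (AddMonoidHom.toMultiplicativeLeft
      (zmultiplesHom _ (unitExp (laurentX k) v))))
  refine encard_Ass_ker_le (ψ : LaurentPolynomial k →+* LaurentRing k (N + 2))
    (toSplit k M w : LaurentRing k (N + 2) →+* SplitAlg k M) ?_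
  have hψ : ∀ c : ℤ, ψ (LaurentPolynomial.T c) = laurentMonomial k (c • v) := by
    intro c
    simp only [ψ, LaurentPolynomial.T]
    rw [AddMonoidAlgebra.lift_single, one_smul, laurentMonomial_eq, map_smul]
    rfl
  have hcomp : (toSplit k M w).comp ψ =
      IsScalarTower.toAlgHom k (LaurentPolynomial k) (SplitAlg k M) := by
    refine AddMonoidAlgebra.algHom_ext (fun c => ?_) (Subsingleton.elim _ _)
    change toSplit k M w (ψ (LaurentPolynomial.T c)) = algebraMap _ _ (LaurentPolynomial.T c)
    rw [hψ, h1, (Submodule.Quotient.mk_eq_zero _).2 (Submodule.smul_mem _ c hv)]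
    rfl
  exact congrArg AlgHom.toRingHom hcomp

theorem encard_Ass_satur_le (k : Type*) [Field k] (hL : IsPCB L) :
    (Ass (satur (pcbIdeal k L))).encard ≤ dGcd L :=
  ((Set.encard_le_encard (Ass_comap_subset
    (Submonoid.powers
      (∏ i : Fin (N + 2), (MvPolynomial.X i : MvPolynomial (Fin (N + 2)) k))) _)).trans
      (Set.encard_image_le _ _)).trans (encard_Ass_ext_le k hL)
end PCB

/-! ### Intersections of finitely many incomparable primes. -/

namespace PCB

section PrimeFamily
variable {R ι : Type*} [CommRing R] {I : Ideal R} {s : Finset ι} {q : ι → Ideal R}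

/-- A finite family of pairwise incomparable primes with intersection `I`. -/
structure IsPrimeIntersection (I : Ideal R) (s : Finset ι) (q : ι → Ideal R) : Prop where
  eq_inf : I = s.inf q
  isPrime : ∀ i ∈ s, (q i).IsPrime
  eq_of_le : ∀ i ∈ s, ∀ j ∈ s, q i ≤ q j → i = j

namespace IsPrimeIntersection

theorem injOn (h : IsPrimeIntersection I s q) : Set.InjOn q s :=
  fun i hi j hj hij => h.eq_of_le i hi j hj hij.le

theorem isMinimalPrimaryDecompositionOf (h : IsPrimeIntersection I s q) :
    IsMinimalPrimaryDecompositionOf I s q := by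
  classical
  refine ⟨h.injOn, ?_, ?_, ?_, ?_⟩
  · rw [h.eq_inf, Finset.inf_image]; rfl
  · intro J hJ
    obtain ⟨i, hi, rfl⟩ := Finset.mem_image.1 hJ
    exact (h.isPrime i hi).isPrimary
  · intro J hJ K hK hne
    obtain ⟨i, hi, rfl⟩ := Finset.mem_image.1 hJ
    obtain ⟨j, hj, rfl⟩ := Finset.mem_image.1 hK
    simp only [Function.onFun, Submodule.colon_univ]
    rwa [(h.isPrime i hi).radical, (h.isPrime j hj).radical]
  · intro J hJ hle
    obtain ⟨i, hi, rfl⟩ := Finset.mem_image.1 hJ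
    obtain ⟨K, hK, hKi⟩ := (h.isPrime i hi).inf_le'.1 hle
    obtain ⟨hne, hK⟩ := Finset.mem_erase.1 hK
    obtain ⟨j, hj, rfl⟩ := Finset.mem_image.1 hK
    exact hne (congrArg q (h.eq_of_le j hj i hi hKi))

theorem Ass_eq (h : IsPrimeIntersection I s q) : Ass I = q '' s := by
  classical
  rw [Ass_eq_associatedPrimes,
    ← h.isMinimalPrimaryDecompositionOf.2.image_radical_eq_associated_primes,
    Finset.coe_image, Set.image_image]
  refine Set.image_congr fun i hi => ?_
  simp only [Submodule.colon_univ]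
  exact (h.isPrime i hi).radical

theorem encard_Ass (h : IsPrimeIntersection I s q) : (Ass I).encard = s.card := by
  rw [h.Ass_eq, h.injOn.encard_image, Set.encard_coe_eq_coe_finsetCard]

theorem isRadical (h : IsPrimeIntersection I s q) : I.IsRadical := by
  intro x ⟨m, hm⟩
  rw [h.eq_inf, Submodule.mem_finsetInf] at hm ⊢
  exact fun i hi => (h.isPrime i hi).mem_of_pow_mem m (hm i hi)

theorem isUnmixed (h : IsPrimeIntersection I s q)
    (hq : ∀ i ∈ s, ∀ j ∈ s, (q i).height = (q j).height) : IsUnmixed I := by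
  intro p hp
  rw [h.Ass_eq] at hp
  obtain ⟨i, hi, rfl⟩ := hp
  apply le_antisymm
  -- A minimal prime of `I` contains some `q j`, and all the `q j` have the height of `q i`.
  · rw [Ideal.height_eq_inf_minimalPrimes I]
    refine le_iInf₂ fun P hP => ?_
    have hPp := hP.1.1
    have : s.inf q ≤ P := h.eq_inf ▸ hP.1.2
    obtain ⟨j, hj, hjP⟩ := hPp.inf_le'.1 this
    exact (hq i hi j hj).trans_le (Ideal.height_mono hjP)
  · exact Ideal.height_mono (h.eq_inf.trans_le (Finset.inf_le hi))

theorem comap {A : Type*} [CommRing A] [Algebra A R] (S : Submonoid A) [IsLocalization S R]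
    (h : IsPrimeIntersection I s q) :
    IsPrimeIntersection (I.comap (algebraMap A R)) s fun i => (q i).comap (algebraMap A R) where
  eq_inf := by
    ext x
    simp [h.eq_inf, Submodule.mem_finsetInf]
  isPrime i hi := (h.isPrime i hi).comap _
  eq_of_le i hi j hj hij := h.eq_of_le i hi j hj <| by
    -- Ideals of a localization are the extensions of their contractions, so incomparability
    -- survives contraction.
    rw [← IsLocalization.map_under S R (q i), ← IsLocalization.map_under S R (q j)]
    exact Ideal.map_mono hij

end IsPrimeIntersection
end PrimeFamily

/-! ### Roots of unity and Lagrange interpolation. -/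

section RootsOfUnity
open Polynomial

variable {k : Type*} [Field k] {m n : ℕ}

theorem prod_nthRootsFinset (hm : m ≠ 0) (hs : (X ^ m - 1 : k[X]).Splits) (hc : (m : k) ≠ 0) :
    ∏ ζ ∈ nthRootsFinset m (1 : k), (X - C ζ) = X ^ m - 1 := by
  classical
  have hnd : (nthRoots m (1 : k)).Nodup := by
    rw [nthRoots]
    exact nodup_roots (separable_X_pow_sub_C 1 hc one_ne_zero)
  rw [nthRootsFinset_def, Finset.prod_eq_multiset_prod, Multiset.toFinset_val, hnd.dedup,
    nthRoots, C_1]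
  exact (hs.eq_prod_roots_of_monic (monic_X_pow_sub_C 1 hm)).symm

theorem card_nthRootsFinset_eq (hm : m ≠ 0) (hs : (X ^ m - 1 : k[X]).Splits) (hc : (m : k) ≠ 0) :
    (nthRootsFinset m (1 : k)).card = m := by
  have := congrArg natDegree (prod_nthRootsFinset hm hs hc)
  rwa [natDegree_prod_of_monic _ _ fun ζ _ => monic_X_sub_C ζ, ← C_1, natDegree_X_pow_sub_C,
    Finset.sum_congr rfl fun ζ _ => natDegree_X_sub_C ζ, Finset.sum_const, smul_eq_mul,
    mul_one] at this

theorem splits_X_pow_sub_one_of_dvd (h : m ∣ n) (hn : n ≠ 0) (hs : (X ^ n - 1 : k[X]).Splits) :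
    (X ^ m - 1 : k[X]).Splits := by
  refine hs.of_dvd ?_ (dvd_pow_sub_one_of_dvd h)
  rw [← C_1]
  exact X_pow_sub_C_ne_zero (Nat.pos_of_ne_zero hn) 1

theorem prod_X_sub_C_dvd_mul_basis [DecidableEq k] {s : Finset k} {ζ : k} (hζ : ζ ∈ s) :
    (∏ ξ ∈ s, (X - C ξ)) ∣ (X - C ζ) * Lagrange.basis s id ζ := by
  rw [← Finset.mul_prod_erase _ _ hζ]
  refine mul_dvd_mul_left _ (Finset.prod_dvd_prod_of_dvd _ _ fun ξ _ => ?_)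
  exact dvd_mul_left _ _

end RootsOfUnity
end PCB

/-! ### Unimodular coordinates on `B` and the ideals `𝔟_λ`. -/

namespace PCB

open Matrix

theorem unitExp_mulVec {M : Type*} [CommGroup M] {m n : ℕ} (g : Fin n → M)
    (A : Matrix (Fin n) (Fin m) ℤ) (u : Fin m → ℤ) :
    unitExp g (A *ᵥ u) = unitExp (fun j => (unitExp g (A.col j)).toMul) u := by
  have := unitExp_sum g u fun j => A.col j
  refine this.trans ?_
  apply Additive.toMul.injective
  simp [toMul_unitExp]

section YCoord
variable {k : Type*} [Field k] {n : ℕ} {R : Type*} [CommRing R]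
  {P : Matrix (Fin n) (Fin n) ℤ}

theorem map_yCoord (f : LaurentRing k n →+* R) (P : Matrix (Fin n) (Fin n) ℤ) (j : Fin n) :
    f (yCoord k P j) = ((unitExp (varUnit f) (P⁻¹.col j)).toMul : Rˣ) :=
  map_laurentMonomial f _

/-- The coordinate `yCoord k P j` as a unit. -/
noncomputable def yUnit (k : Type*) [Field k] (P : Matrix (Fin n) (Fin n) ℤ) (j : Fin n) :
    (LaurentRing k n)ˣ := (isUnit_laurentMonomial fun l => P⁻¹ l j).unit

@[simp]
theorem val_yUnit (P : Matrix (Fin n) (Fin n) ℤ) (j : Fin n) :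
    (yUnit k P j : LaurentRing k n) = yCoord k P j := rfl

variable [Algebra k R]

/-- The exponents `P⁻¹` are invertible over `ℤ`: each `x_l` is the monomial in the `y` with
exponents the `l`-th column of `P`. -/
theorem algHom_ext_yCoord (hP : IsUnit P.det) {f g : LaurentRing k n →ₐ[k] R}
    (h : ∀ j, f (yCoord k P j) = g (yCoord k P j)) : f = g := by
  have key : ∀ (f : LaurentRing k n →ₐ[k] R) (l : Fin n), varUnit (f : LaurentRing k n →+* R) l =
      (unitExp (fun j => (unitExp (varUnit (f : LaurentRing k n →+* R)) (P⁻¹.col j)).toMul)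
        (P.col l)).toMul := by
    intro f l
    rw [← unitExp_mulVec]
    have : P⁻¹ *ᵥ P.col l = Pi.single l 1 := by
      rw [← mulVec_single_one, mulVec_mulVec, nonsing_inv_mul _ hP, one_mulVec]
    rw [this, unitExp_single_one]
    rfl
  refine laurentRing_algHom_ext fun l => ?_
  refine congrArg Units.val (a₁ := varUnit (f : LaurentRing k n →+* R) l)
    (a₂ := varUnit (g : LaurentRing k n →+* R) l) ?_
  rw [key f, key g]
  congr 3
  ext1 j
  apply Units.ext
  rw [← map_yCoord, ← map_yCoord]
  exact h j

/-- The homomorphism from the Laurent polynomial ring that sends the coordinates `yCoord k P` to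
given units. -/
noncomputable def yLift (P : Matrix (Fin n) (Fin n) ℤ) (h : Fin n → Rˣ) :
    LaurentRing k n →ₐ[k] R :=
  laurentLift fun l => (unitExp h (P.col l)).toMul

theorem yLift_yCoord (hP : IsUnit P.det) (h : Fin n → Rˣ) (j : Fin n) :
    yLift P h (yCoord k P j) = h j := by
  rw [yLift, yCoord, laurentLift_laurentMonomial, ← unitExp_mulVec]
  have : (P *ᵥ fun l => P⁻¹ l j) = Pi.single j 1 := by
    change P *ᵥ P⁻¹.col j = _
    rw [← mulVec_single_one, mulVec_mulVec, mul_nonsing_inv _ hP, one_mulVec]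
  rw [this, unitExp_single_one]
  rfl

/-- The rescaled coordinates, as units. -/
noncomputable def scaledYUnit (P : Matrix (Fin n) (Fin n) ℤ) (c : Fin n → kˣ) (j : Fin n) :
    (LaurentRing k n)ˣ :=
  Units.map (algebraMap k (LaurentRing k n) : k →* LaurentRing k n) (c j) * yUnit k P j

theorem val_scaledYUnit (P : Matrix (Fin n) (Fin n) ℤ) (c : Fin n → kˣ) (j : Fin n) :
    (scaledYUnit P c j : LaurentRing k n) = algebraMap k _ (c j : k) * yCoord k P j := rfl

theorem yLift_scaledYUnit_comp (hP : IsUnit P.det) (c d : Fin n → kˣ) (h : ∀ j, c j * d j = 1) :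
    (yLift P (scaledYUnit P c)).comp (yLift P (scaledYUnit P d)) =
      AlgHom.id k (LaurentRing k n) :=
  algHom_ext_yCoord hP fun j => by
    rw [AlgHom.comp_apply, yLift_yCoord hP, val_scaledYUnit, map_mul, AlgHom.commutes,
      yLift_yCoord hP, val_scaledYUnit, ← mul_assoc, ← map_mul, mul_comm (d j : k),
      ← Units.val_mul, h, Units.val_one, map_one, one_mul, AlgHom.id_apply]

/-- The automorphism of the Laurent polynomial ring that rescales the coordinates. -/
noncomputable def yScale (hP : IsUnit P.det) (c : Fin n → kˣ) :
    LaurentRing k n ≃ₐ[k] LaurentRing k n :=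
  AlgEquiv.ofAlgHom (yLift P (scaledYUnit P c)) (yLift P (scaledYUnit P c⁻¹))
    (yLift_scaledYUnit_comp hP _ _ fun _ => mul_inv_cancel _)
    (yLift_scaledYUnit_comp hP _ _ fun _ => inv_mul_cancel _)

theorem yScale_yCoord (hP : IsUnit P.det) (c : Fin n → kˣ) (j : Fin n) :
    yScale hP c (yCoord k P j) = algebraMap k _ (c j : k) * yCoord k P j :=
  yLift_yCoord hP _ j
end YCoord

section BIdeal
variable {k : Type*} [Field k] {N : ℕ} {P : Matrix (Fin (N + 2)) (Fin (N + 2)) ℤ}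

/-- The homomorphism to `k[T;T⁻¹]` that sends the first coordinates to the given scalars and the
last one to `T`. -/
noncomputable def yEval (P : Matrix (Fin (N + 2)) (Fin (N + 2)) ℤ) (lam : Fin (N + 1) → kˣ) :
    LaurentRing k (N + 2) →ₐ[k] LaurentPolynomial k :=
  yLift P (Fin.lastCases (LaurentPolynomial.isUnit_T 1).unit
    fun i => Units.map (algebraMap k (LaurentPolynomial k) : k →* _) (lam i))

theorem yEval_castSucc (hP : IsUnit P.det) (lam : Fin (N + 1) → kˣ) (i : Fin (N + 1)) :
    yEval P lam (yCoord k P i.castSucc) = algebraMap k _ (lam i : k) := by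
  rw [yEval, yLift_yCoord hP, Fin.lastCases_castSucc]
  rfl

theorem yEval_last (hP : IsUnit P.det) (lam : Fin (N + 1) → kˣ) :
    yEval P lam (yCoord k P (Fin.last _)) = LaurentPolynomial.T 1 := by
  rw [yEval, yLift_yCoord hP, Fin.lastCases_last]
  rfl

/-- The map `T ↦ yₙ` back to `B` inverts the evaluation modulo `𝔟_λ`, as a check on the coordinates
shows, so whatever evaluates to zero lies in `𝔟_λ`. -/
theorem ker_yEval (hP : IsUnit P.det) (lam : Fin (N + 1) → kˣ) :
    RingHom.ker (yEval P lam) = bIdeal P fun i => (lam i : k) := by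
  apply le_antisymm
  · let ψ : LaurentPolynomial k →ₐ[k] LaurentRing k (N + 2) := AddMonoidAlgebra.lift k _ ℤ
      ((Units.coeHom _).comp (zpowersHom _ (yUnit k P (Fin.last _))))
    have hψ : ψ (LaurentPolynomial.T 1) = yCoord k P (Fin.last _) := by
      simp only [ψ, LaurentPolynomial.T]
      rw [AddMonoidAlgebra.lift_single, one_smul]
      simp
    have hcomp : (Ideal.Quotient.mkₐ k (bIdeal P fun i => (lam i : k))).comp
        (ψ.comp (yEval P lam)) = Ideal.Quotient.mkₐ k _ := by
      refine algHom_ext_yCoord hP fun j => ?_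
      refine Fin.lastCases ?_ (fun i => ?_) j
      · rw [AlgHom.comp_apply, AlgHom.comp_apply, yEval_last hP, hψ]
      · rw [AlgHom.comp_apply, AlgHom.comp_apply, yEval_castSucc hP, ψ.commutes]
        symm
        exact Ideal.Quotient.eq.2 (Ideal.subset_span ⟨i, rfl⟩)
    intro b hb
    rw [RingHom.mem_ker] at hb
    have := DFunLike.congr_fun hcomp b
    rw [AlgHom.comp_apply, AlgHom.comp_apply, hb, map_zero, map_zero] at this
    exact Ideal.Quotient.eq_zero_iff_mem.1 this.symm
  · rw [bIdeal, Ideal.span_le]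
    rintro _ ⟨i, rfl⟩
    simp only [SetLike.mem_coe, RingHom.mem_ker, map_sub, yEval_castSucc hP, AlgHom.commutes,
      sub_self]

theorem isPrime_bIdeal (hP : IsUnit P.det) (lam : Fin (N + 1) → kˣ) :
    (bIdeal P fun i => (lam i : k)).IsPrime := by
  rw [← ker_yEval hP]
  exact RingHom.ker_isPrime _

theorem eq_of_bIdeal_le (hP : IsUnit P.det) {lam mu : Fin (N + 1) → kˣ}
    (h : bIdeal P (fun i => (lam i : k)) ≤ bIdeal P fun i => (mu i : k)) : lam = mu := by
  funext i
  have hmem : yCoord k P i.castSucc - algebraMap k _ (lam i : k) ∈ bIdeal P fun i => (mu i : k) :=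
    h (Ideal.subset_span ⟨i, rfl⟩)
  rw [← ker_yEval hP, RingHom.mem_ker, map_sub, yEval_castSucc hP, AlgHom.commutes,
    sub_eq_zero] at hmem
  exact Units.ext (FaithfulSMul.algebraMap_injective k (LaurentPolynomial k) hmem).symm

/-- The automorphism of `B` that scales `yᵢ` by `λᵢ / μᵢ` and fixes `yₙ` pulls `𝔟_μ` back to `𝔟_λ`,
so the common height need not be computed. -/
theorem height_bIdeal_eq (hP : IsUnit P.det) (lam mu : Fin (N + 1) → kˣ) :
    (bIdeal P fun i => (lam i : k)).height = (bIdeal P fun i => (mu i : k)).height := by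
  have hcomp : (yEval P mu).comp
      (yScale hP (Fin.lastCases 1 fun i => lam i / mu i)).toAlgHom = yEval P lam := by
    refine algHom_ext_yCoord hP fun j => ?_
    rw [AlgHom.comp_apply]
    change yEval P mu (yScale hP _ (yCoord k P j)) = _
    rw [yScale_yCoord, map_mul, AlgHom.commutes]
    refine Fin.lastCases ?_ (fun i => ?_) j
    · simp [yEval_last hP]
    · rw [yEval_castSucc hP, yEval_castSucc hP, Fin.lastCases_castSucc, ← map_mul]
      simp
  have hcomap : bIdeal P (fun i => (lam i : k)) = (bIdeal P fun i => (mu i : k)).comap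
      (yScale hP (Fin.lastCases 1 fun i => lam i / mu i)).toRingEquiv := by
    rw [← ker_yEval hP, ← ker_yEval hP, ← hcomp]
    rfl
  rw [hcomap]
  exact RingEquiv.height_comap _ _
end BIdeal
end PCB

/-! ### The decomposition of `IB` over a field with enough roots of unity. -/

namespace PCB

open Matrix

variable {k : Type*} [Field k] {N : ℕ} {L P Q : Matrix (Fin (N + 2)) (Fin (N + 2)) ℤ}
  {δ : Fin (N + 2) → ℕ}

theorem yCoord_pow (i : Fin (N + 2)) (m : ℕ) :
    yCoord k P i ^ m = laurentMonomial k ((m : ℤ) • P⁻¹.col i) := by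
  rw [yCoord, laurentMonomial_eq, laurentMonomial_eq, map_smul, natCast_zsmul, toMul_nsmul,
    Units.val_pow_eq_pow_val]
  rfl

/-- From `L * Q = P⁻¹ * D` with `Q` unimodular, the columns of `L` and the vectors `dᵢ rᵢ` span the
same lattice. The last one is zero and contributes no generator. -/
theorem ext_pcbIdeal_eq_span_yCoord (hL : IsPCB L) (h : IsNormalDecomposition L P Q δ) :
    ext (pcbIdeal k L) = Ideal.span (Set.range fun i : Fin (N + 1) =>
      yCoord k P i.castSucc ^ δ i.castSucc - 1) := by
  rw [ext_pcbIdeal]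
  apply le_antisymm <;> rw [Ideal.span_le] <;> rintro _ ⟨j, rfl⟩ <;> simp only [SetLike.mem_coe]
  · set J := Ideal.span (Set.range fun i : Fin (N + 1) =>
      yCoord k P i.castSucc ^ δ i.castSucc - 1)
    rw [laurentMonomial_sub_one_mem_iff]
    have hcol : (fun i => L i j) = ∑ i, Q⁻¹ i j • (δ i : ℤ) • P⁻¹.col i := by
      ext l
      conv_lhs => rw [h.eq_mul, mul_apply]
      rw [Finset.sum_apply]
      refine Finset.sum_congr rfl fun i _ => ?_
      simp only [mul_diagonal, Pi.smul_apply, col_apply, smul_eq_mul]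
      ring
    rw [hcol, map_sum]
    refine Finset.sum_eq_zero fun i _ => ?_
    rw [map_smul]
    have : unitExp (varUnit (Ideal.Quotient.mk J)) ((δ i : ℤ) • P⁻¹.col i) = 0 := by
      refine Fin.lastCases ?_ (fun i => ?_) i
      · rw [h.last_eq_zero hL, Nat.cast_zero, zero_smul, map_zero]
      · rw [← laurentMonomial_sub_one_mem_iff, ← yCoord_pow]
        exact Ideal.subset_span ⟨i, rfl⟩
    rw [this, smul_zero]
  · set J := Ideal.span (Set.range fun j => laurentMonomial k (fun i => L i j) - 1)
    rw [yCoord_pow, laurentMonomial_sub_one_mem_iff]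
    have hcol : (δ j.castSucc : ℤ) • P⁻¹.col j.castSucc =
        ∑ i, Q i j.castSucc • fun l => L l i := by
      ext l
      have := congrFun (congrFun h.mul_eq l) j.castSucc
      rw [mul_apply, mul_diagonal] at this
      simp only [Pi.smul_apply, col_apply, smul_eq_mul, Finset.sum_apply]
      rw [mul_comm, ← this]
      exact Finset.sum_congr rfl fun i _ => mul_comm _ _
    rw [hcol, map_sum]
    refine Finset.sum_eq_zero fun i _ => ?_
    rw [map_smul, (laurentMonomial_sub_one_mem_iff J _).1 (Ideal.subset_span ⟨i, rfl⟩), smul_zero]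

theorem exists_units_of_mem_Lam (hδ : ∀ i : Fin (N + 1), δ i.castSucc ≠ 0) {lam : Fin (N + 1) → k}
    (h : lam ∈ Lam k δ) : ∃ u : Fin (N + 1) → kˣ, lam = fun i => (u i : k) := by
  have hpow : ∀ i, lam i ^ δ i.castSucc = 1 := fun i =>
    (Polynomial.mem_nthRootsFinset (Nat.pos_of_ne_zero (hδ i)) 1).1 (Fintype.mem_piFinset.1 h i)
  exact ⟨fun i => Units.mk0 (lam i) fun h0 => by
    have := hpow i
    rw [h0, zero_pow (hδ i)] at this
    exact zero_ne_one this, rfl⟩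

/-- With `e_λ` the product over `i` of the Lagrange basis polynomials at `λᵢ`, evaluated at `yᵢ`,
the `e_λ` sum to `1` and `e_λ 𝔟_λ` lies in the left-hand ideal. Thus `f = ∑ f e_λ` lies there as
soon as `f` is in every `𝔟_λ`. -/
theorem span_yCoord_eq_inf (hδ : ∀ i : Fin (N + 1), δ i.castSucc ≠ 0)
    (hprod : ∀ i : Fin (N + 1), ∏ ζ ∈ Polynomial.nthRootsFinset (δ i.castSucc) (1 : k),
      (Polynomial.X - Polynomial.C ζ) = Polynomial.X ^ δ i.castSucc - 1) :
    Ideal.span (Set.range fun i : Fin (N + 1) => yCoord k P i.castSucc ^ δ i.castSucc - 1) =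
      (Lam k δ).inf fun lam => bIdeal P lam := by
  classical
  set I := Ideal.span (Set.range fun i : Fin (N + 1) => yCoord k P i.castSucc ^ δ i.castSucc - 1)
  apply le_antisymm
  · refine Finset.le_inf fun lam hlam => ?_
    rw [Ideal.span_le]
    rintro _ ⟨i, rfl⟩
    have hpow : lam i ^ δ i.castSucc = 1 :=
      (Polynomial.mem_nthRootsFinset (Nat.pos_of_ne_zero (hδ i)) 1).1
        (Fintype.mem_piFinset.1 hlam i)
    have hmem : yCoord k P i.castSucc - algebraMap k (LaurentRing k (N + 2)) (lam i) ∈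
      bIdeal P lam := Ideal.subset_span ⟨i, rfl⟩
    have hdvd := sub_dvd_pow_sub_pow (yCoord k P i.castSucc)
      (algebraMap k (LaurentRing k (N + 2)) (lam i)) (δ i.castSucc)
    rw [← map_pow, hpow, map_one] at hdvd
    exact Ideal.mem_of_dvd _ hdvd hmem
  · let e : Fin (N + 1) → k → LaurentRing k (N + 2) := fun i ζ =>
      Polynomial.aeval (yCoord k P i.castSucc)
        (Lagrange.basis (Polynomial.nthRootsFinset (δ i.castSucc) (1 : k)) id ζ)
    have hsum : ∑ lam ∈ Lam k δ, ∏ i, e i (lam i) = 1 := by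
      rw [Lam, ← Finset.prod_univ_sum]
      refine Finset.prod_eq_one fun i _ => ?_
      simp only [e]
      rw [← map_sum, Lagrange.sum_basis Function.injective_id.injOn, map_one]
      exact ⟨1, (Polynomial.mem_nthRootsFinset (Nat.pos_of_ne_zero (hδ i)) 1).2 (one_pow _)⟩
    have hle : ∀ lam ∈ Lam k δ, ∀ f ∈ bIdeal P lam, f * ∏ i, e i (lam i) ∈ I := by
      intro lam hlam
      suffices h : bIdeal P lam ≤ Submodule.colon I {∏ i, e i (lam i)} from fun f hf =>
        Submodule.mem_colon_singleton.1 (h hf)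
      rw [bIdeal, Ideal.span_le]
      rintro _ ⟨i, rfl⟩
      rw [SetLike.mem_coe, Submodule.mem_colon_singleton, smul_eq_mul,
        ← Finset.mul_prod_erase _ _ (Finset.mem_univ i), ← mul_assoc]
      refine Ideal.mul_mem_right _ _ ?_
      -- The factor `X - λᵢ` is the one missing from the basis polynomial, so the product is
      -- divisible by `X ^ dᵢ - 1`.
      have hdvd := prod_X_sub_C_dvd_mul_basis (Fintype.mem_piFinset.1 hlam i)
      rw [hprod i] at hdvd
      have := map_dvd (Polynomial.aeval (yCoord k P i.castSucc)) hdvd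
      simp only [map_sub, map_mul, map_pow, Polynomial.aeval_X, Polynomial.aeval_C, map_one] at this
      exact Ideal.mem_of_dvd _ this (Ideal.subset_span ⟨i, rfl⟩)
    intro f hf
    rw [← mul_one f, ← hsum, Finset.mul_sum]
    exact Ideal.sum_mem _ fun lam hlam => hle lam hlam f ((Submodule.mem_finsetInf.1 hf) lam hlam)

theorem isPrimeIntersection_ext (hL : IsPCB L) (h : IsNormalDecomposition L P Q δ)
    (hs : ∀ i : Fin (N + 1), (Polynomial.X ^ δ i.castSucc - 1 : Polynomial k).Splits)
    (hc : ∀ i : Fin (N + 1), (δ i.castSucc : k) ≠ 0) :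
    IsPrimeIntersection (ext (pcbIdeal k L)) (Lam k δ) fun lam => bIdeal P lam where
  eq_inf := by
    rw [ext_pcbIdeal_eq_span_yCoord hL h]
    exact span_yCoord_eq_inf (h.castSucc_ne_zero hL) fun i =>
      prod_nthRootsFinset (h.castSucc_ne_zero hL i) (hs i) (hc i)
  isPrime lam hlam := by
    obtain ⟨u, rfl⟩ := exists_units_of_mem_Lam (h.castSucc_ne_zero hL) hlam
    exact isPrime_bIdeal h.isUnit_P u
  eq_of_le lam hlam mu hmu hle := by
    obtain ⟨u, rfl⟩ := exists_units_of_mem_Lam (h.castSucc_ne_zero hL) hlam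
    obtain ⟨v, rfl⟩ := exists_units_of_mem_Lam (h.castSucc_ne_zero hL) hmu
    rw [eq_of_bIdeal_le h.isUnit_P hle]

theorem card_Lam (hL : IsPCB L) (h : IsNormalDecomposition L P Q δ)
    (hs : ∀ i : Fin (N + 1), (Polynomial.X ^ δ i.castSucc - 1 : Polynomial k).Splits)
    (hc : ∀ i : Fin (N + 1), (δ i.castSucc : k) ≠ 0) : (Lam k δ).card = dGcd L := by
  rw [Lam, Fintype.card_piFinset, ← h.prod_eq_dGcd hL]
  exact Finset.prod_congr rfl fun i _ =>
    card_nthRootsFinset_eq (h.castSucc_ne_zero hL i) (hs i) (hc i)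
end PCB

/-- Here `n = N + 2`, and `d_{n-1}` is `δ (Fin.last N).castSucc`. -/
theorem theorem5p7 (k : Type*) [Field k] (N : ℕ) (L : Matrix (Fin (N + 2)) (Fin (N + 2)) ℤ)
    (hL : PCB.IsPCB L) :
    (∀ (P Q : Matrix (Fin (N + 2)) (Fin (N + 2)) ℤ) (δ : Fin (N + 2) → ℕ),
      PCB.IsNormalDecomposition L P Q δ →
      (Polynomial.X ^ δ (Fin.last N).castSucc - 1 : Polynomial k).Splits →
      (ringChar k = 0 ∨ ¬ ringChar k ∣ δ (Fin.last N).castSucc) →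
        PCB.IsMinimalPrimaryDecompositionOf (PCB.ext (PCB.pcbIdeal k L))
          (PCB.Lam k δ) (fun lam => PCB.bIdeal P lam) ∧
        PCB.IsMinimalPrimaryDecompositionOf (PCB.satur (PCB.pcbIdeal k L))
          (PCB.Lam k δ) (fun lam => PCB.contr (PCB.bIdeal P lam)) ∧
        PCB.IsUnmixed (PCB.ext (PCB.pcbIdeal k L)) ∧
        PCB.IsUnmixed (PCB.satur (PCB.pcbIdeal k L)) ∧
        (PCB.ext (PCB.pcbIdeal k L)).IsRadical ∧
        (PCB.satur (PCB.pcbIdeal k L)).IsRadical ∧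
        (PCB.Ass (PCB.ext (PCB.pcbIdeal k L))).encard = (PCB.dGcd L : ℕ∞) ∧
        (PCB.Ass (PCB.satur (PCB.pcbIdeal k L))).encard = (PCB.dGcd L : ℕ∞)) ∧
    (PCB.Ass (PCB.ext (PCB.pcbIdeal k L))).encard ≤ (PCB.dGcd L : ℕ∞) ∧
    (PCB.Ass (PCB.satur (PCB.pcbIdeal k L))).encard ≤ (PCB.dGcd L : ℕ∞) := by
  refine ⟨fun P Q δ h hsplit hchar => ?_, PCB.encard_Ass_ext_le k hL,
    PCB.encard_Ass_satur_le k hL⟩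
  have hδ := h.castSucc_ne_zero hL
  -- Divisibility carries the hypotheses on roots of unity and characteristic from `d_{n-1}` to
  -- every `dᵢ`.
  have hdvd : ∀ i : Fin (N + 1), δ i.castSucc ∣ δ (Fin.last N).castSucc := fun i =>
    h.dvd _ _ (Fin.castSucc_le_castSucc_iff.2 (Fin.le_last i))
  have hs : ∀ i : Fin (N + 1), (Polynomial.X ^ δ i.castSucc - 1 : Polynomial k).Splits := fun i =>
    PCB.splits_X_pow_sub_one_of_dvd (hdvd i) (hδ _) hsplit
  have hc : ∀ i : Fin (N + 1), (δ i.castSucc : k) ≠ 0 := by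
    intro i hi
    have hlast := (ringChar.spec k _).1 hi |>.trans (hdvd i)
    rcases hchar with h0 | h0
    · rw [h0, zero_dvd_iff] at hlast
      exact hδ _ hlast
    · exact h0 hlast
  have hB := PCB.isPrimeIntersection_ext hL h hs hc
  have hA : PCB.IsPrimeIntersection (PCB.satur (PCB.pcbIdeal k L)) (PCB.Lam k δ)
      fun lam => PCB.contr (PCB.bIdeal P lam) :=
    hB.comap (Submonoid.powers
      (∏ i : Fin (N + 2), (MvPolynomial.X i : MvPolynomial (Fin (N + 2)) k)))
  have hheight : ∀ lam ∈ PCB.Lam k δ, ∀ mu ∈ PCB.Lam k δ,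
      (PCB.bIdeal P lam).height = (PCB.bIdeal P mu).height := by
    intro lam hlam mu hmu
    obtain ⟨u, rfl⟩ := PCB.exists_units_of_mem_Lam hδ hlam
    obtain ⟨v, rfl⟩ := PCB.exists_units_of_mem_Lam hδ hmu
    exact PCB.height_bIdeal_eq h.isUnit_P u v
  refine ⟨hB.isMinimalPrimaryDecompositionOf, hA.isMinimalPrimaryDecompositionOf,
    hB.isUnmixed hheight, hA.isUnmixed fun lam hlam mu hmu => ?_,
    hB.isRadical, hA.isRadical, ?_, ?_⟩
  -- Contraction from a localization preserves height, so the equality of heights passes to `A`.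
  · have hh : ∀ lam : Fin (N + 1) → k,
        (PCB.contr (PCB.bIdeal P lam)).height = (PCB.bIdeal P lam).height := fun lam =>
      IsLocalization.height_under (Submonoid.powers
        (∏ i : Fin (N + 2), (MvPolynomial.X i : MvPolynomial (Fin (N + 2)) k))) _
    rw [hh, hh, hheight lam hlam mu hmu]
  · rw [hB.encard_Ass, PCB.card_Lam hL h hs hc]
  · rw [hA.encard_Ass, PCB.card_Lam hL h hs hc]
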